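/- Let $R$ be an associative ring with identity $1$, not necessarily commutative, and let $E=(E^0,E^1,s,r)$ be a directed graph with a finite set $E^0$ of vertices, an arbitrary set $E^1$ of edges, and source and range maps $s,r:E^1\to E^0$. The Cohn path ring $C_R(E)$ is the unital $R$-ring generated by $E^0\cup E^1\cup\{e^*:e\in E^1\}$, where every generator commutes with every element of $R$, subject to the relations $vw=\delta_{v,w}v$ for $v,w\in E^0$; $s(e)e=e=e\,r(e)$ and $r(e)e^*=e^*=e^*s(e)$ for $e\in E^1$; $\sum_{v\in E^0}v=1$; and $e^*f=\delta_{e,f}\,r(e)$ for $e,f\in E^1$. A ring $S$ satisfies the rank condition if there is no positive integer $n$ for which there is an epimorphism $S^n\to S^{n+1}$ of right $S$-modules. The generating number $\mathrm{gn}(S)$ is $\aleph_0$ if $S$ satisfies the rank condition, and otherwise it is the smallest positive integer $n$ for which there is an epimorphism $S^n\to S^{n+1}$ of right $S$-modules. For $v,w\in E^0$ write $v\ge w$ if there is a path (possibly of length $0$) from $v$ to $w$. A set $Y\subseteq E^0$ is hereditary if $y\in Y$ and $y\ge v$ imply $v\in Y$. A cycle is a path $(e_1,\dots,e_n)$ with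 $n\ge 1$, $r(e_n)=s(e_1)$ and $s(e_1),\dots,s(e_n)$ pairwise distinct; its vertices are $s(e_1),\dots,s(e_n)$. For cycles $\omega,\xi$ write $\omega\ge\xi$ if $v\ge w$ for some vertex $v$ of $\omega$ and some vertex $w$ of $\xi$; a cycle $\omega$ is maximal if $\omega\geq\xi$ for every cycle $\xi$ with $\xi\ge\omega$. A cycle $\omega$ is exclusive if it shares no vertex with any other cycle, where the cyclic rotations of $\omega$ are not counted as other cycles. Let $X$ be the smallest hereditary subset of $E^0$ that contains all the vertices of all the cycles of $E$. Then the following statements are equivalent. (i) $C_R(E)$ satisfies the rank condition. (ii) $R$ satisfies the rank condition, and $\mathrm{gn}(C_R(E))>1$. (iii) $R$ satisfies the rank condition, and at least one of (1) and (2) holds: (1) $X\neq E^0$; (2) $E$ contains an exclusive maximal cycle. -/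

import Mathlib

/-- A directed graph with vertex set `V` and edge set `A`: every edge has a source and a range.
Loops, multiple edges and infinitely many edges are allowed. -/
structure DirectedGraph (V : Type*) (A : Type*) where
  source : A → V
  range : A → V

namespace DirectedGraph

variable {V A : Type*} (E : DirectedGraph V A)

/-- `E.IsPath v p w`: the list of edges `p` is a path from `v` to `w`, that is, the range of each
edge except the last is the source of the next one. The empty list is the path of length `0`
at a vertex. -/
def IsPath : V → List A → V → Prop
  | v, [], w => v = w
  | v, e :: p, w => E.source e = v ∧ IsPath (E.range e) p w

/-- The quasiordering on the vertices: `v ≥ w` if there is a path from `v` to `w`. -/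
def Reaches (v w : V) : Prop := ∃ p : List A, E.IsPath v p w

/-- A cycle `(e₁, …, eₙ)`: a closed path of positive length, the sources of whose edges are
pairwise distinct. -/
def IsCycle (c : List A) : Prop :=
  c ≠ [] ∧ (∃ v, E.IsPath v c v) ∧ (c.map E.source).Nodup

/-- The set of vertices on a cycle. -/
def cycleVertices (c : List A) : Set V := {v | ∃ e ∈ c, E.source e = v}

/-- The quasiordering on cycles induced by the one on vertices. -/
def CycleReaches (c d : List A) : Prop :=
  ∃ v ∈ E.cycleVertices c, ∃ w ∈ E.cycleVertices d, E.Reaches v w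

/-- A cycle that is a maximal element of the set of all cycles for the quasiordering. -/
def IsMaximalCycle (c : List A) : Prop :=
  E.IsCycle c ∧ ∀ d, E.IsCycle d → E.CycleReaches d c → E.CycleReaches c d

/-- A cycle that shares no vertex with any other cycle. Here the cyclic rotations of a cycle,
which differ from it only in the choice of the basepoint, are not counted as other cycles. -/
def IsExclusiveCycle (c : List A) : Prop :=
  E.IsCycle c ∧
    ∀ d, E.IsCycle d → (E.cycleVertices c ∩ E.cycleVertices d).Nonempty → d.IsRotated c

/-- `X` is hereditary if `v ∈ X` whenever some `x ∈ X` satisfies `x ≥ v`. -/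
def IsHereditary (X : Set V) : Prop := ∀ x ∈ X, ∀ v, E.Reaches x v → v ∈ X

/-- The smallest hereditary set of vertices that contains all the vertices of all the cycles. -/
def cycleHull : Set V :=
  ⋂₀ {X | E.IsHereditary X ∧ ∀ c, E.IsCycle c → E.cycleVertices c ⊆ X}

theorem isLeast_cycleHull :
    IsLeast {X | E.IsHereditary X ∧ ∀ c, E.IsCycle c → E.cycleVertices c ⊆ X} E.cycleHull :=
  ⟨⟨fun x hx v hv Y hY => hY.1 x (hx Y hY) v hv, fun c hc _ hv _ hY => hY.2 c hc hv⟩,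
    fun _ hY => Set.sInter_subset_of_mem hY⟩

end DirectedGraph

/-- The generators of a Cohn path ring: vertices, edges, and a ghost edge `e*` for each edge. -/
inductive CohnGen (V A : Type*)
  | vertex (v : V) : CohnGen V A
  | edge (e : A) : CohnGen V A
  | ghost (e : A) : CohnGen V A

/-- The free `R`-ring on the generators subject to the condition that the generators commute with
the elements of `R`: noncommutative polynomials in the generators with coefficients in `R`. -/
abbrev CohnFree (R V A : Type*) [Ring R] := MonoidAlgebra R (FreeMonoid (CohnGen V A))

namespace CohnFree

variable (R : Type*) [Ring R] {V A : Type*}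

noncomputable def vertex (v : V) : CohnFree R V A :=
  MonoidAlgebra.of R _ (FreeMonoid.of (CohnGen.vertex v))

noncomputable def edge (e : A) : CohnFree R V A :=
  MonoidAlgebra.of R _ (FreeMonoid.of (CohnGen.edge e))

noncomputable def ghost (e : A) : CohnFree R V A :=
  MonoidAlgebra.of R _ (FreeMonoid.of (CohnGen.ghost e))

end CohnFree

open CohnFree in
/-- The defining relations of the Cohn path ring. -/
inductive CohnRel (R : Type*) [Ring R] {V A : Type*} [Fintype V] (E : DirectedGraph V A) :
    CohnFree R V A → CohnFree R V A → Prop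
  | vertex_mul_self (v : V) : CohnRel R E (vertex R v * vertex R v) (vertex R v)
  | vertex_mul_of_ne (v w : V) (h : v ≠ w) : CohnRel R E (vertex R v * vertex R w) 0
  | source_mul_edge (e : A) : CohnRel R E (vertex R (E.source e) * edge R e) (edge R e)
  | edge_mul_range (e : A) : CohnRel R E (edge R e * vertex R (E.range e)) (edge R e)
  | sum_vertex : CohnRel R E (∑ v : V, vertex R v) 1
  | range_mul_ghost (e : A) : CohnRel R E (vertex R (E.range e) * ghost R e) (ghost R e)
  | ghost_mul_source (e : A) : CohnRel R E (ghost R e * vertex R (E.source e)) (ghost R e)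
  | ghost_mul_self (e : A) : CohnRel R E (ghost R e * edge R e) (vertex R (E.range e))
  | ghost_mul_of_ne (e f : A) (h : e ≠ f) : CohnRel R E (ghost R e * edge R f) 0

/-- The Cohn path ring `C_R(E)`. -/
abbrev CohnPathRing (R : Type*) [Ring R] {V A : Type*} [Fintype V] (E : DirectedGraph V A) :=
  RingQuot (CohnRel R E)

/-- There is an epimorphism `Sⁿ → Sⁿ⁺¹` of right `S`-modules. -/
def HasEpiSucc (S : Type*) [Ring S] (n : ℕ) : Prop :=
  ∃ f : (Fin n → S) →ₗ[Sᵐᵒᵖ] (Fin (n + 1) → S), Function.Surjective f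

/-- The rank condition: for no positive integer `n` is there an epimorphism `Sⁿ → Sⁿ⁺¹` of right
`S`-modules. -/
def SatisfiesRankCondition (S : Type*) [Ring S] : Prop :=
  ∀ n : ℕ, 0 < n → ¬ HasEpiSucc S n

open Classical in
/-- The generating number: `ℵ₀` if `S` satisfies the rank condition, and otherwise the smallest
positive integer `n` for which there is an epimorphism `Sⁿ → Sⁿ⁺¹` of right `S`-modules. -/
noncomputable def generatingNumber (S : Type*) [Ring S] : Cardinal.{0} :=
  if SatisfiesRankCondition S then Cardinal.aleph0
  else ((sInf {n : ℕ | 0 < n ∧ HasEpiSucc S n} : ℕ) : Cardinal.{0})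

/-! The rank condition pulls back along ring homomorphisms. So it passes from C = C_R(E) to R, and
conversely it is enough to map C to a matrix ring over R. Such a map comes from a nonempty set Y of
vertices, closed under predecessors, such that the edges ending in Y have distinct sources: vertices
and edges go to matrix units indexed by Y, or to zero when they fall outside Y
(`exists_ringHom_matrix`). If X ≠ E^0, a single vertex without incoming edges serves as Y; otherwise
the vertices of an exclusive maximal cycle do, because only its own edges end on it.

If neither (1) nor (2) holds, every vertex w is reached from a vertex v carrying two closed paths p,
q, neither a prefix of the other (`exists_isBranching_reaches`). The elements p^k q then give
infinitely many independent copies of vC inside vC, and a path from v to w makes wC a summand of vC.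
Hence two copies of C = ⊕ wC fit into C as a summand, which gives an epimorphism C → C² and gn(C) =
1. -/

namespace DirectedGraph

variable {V A : Type*} {E : DirectedGraph V A}

/-! ### Paths, cycles and branching vertices -/

theorem IsPath.append {u v w : V} {p q : List A} (hp : E.IsPath u p v) (hq : E.IsPath v q w) :
    E.IsPath u (p ++ q) w := by
  induction p generalizing u with
  | nil => cases hp; exact hq
  | cons e p ih => exact ⟨hp.1, ih hp.2⟩

theorem IsPath.of_append {u w : V} {p q : List A} (h : E.IsPath u (p ++ q) w) :
    ∃ v, E.IsPath u p v ∧ E.IsPath v q w := by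
  induction p generalizing u with
  | nil => exact ⟨u, rfl, h⟩
  | cons e p ih =>
    obtain ⟨v, hp, hq⟩ := ih h.2
    exact ⟨v, ⟨h.1, hp⟩, hq⟩

theorem Reaches.refl (v : V) : E.Reaches v v := ⟨[], rfl⟩

theorem Reaches.trans {u v w : V} (h : E.Reaches u v) (h' : E.Reaches v w) : E.Reaches u w := by
  obtain ⟨p, hp⟩ := h
  obtain ⟨q, hq⟩ := h'
  exact ⟨p ++ q, hp.append hq⟩

variable (E) in
theorem reaches_edge (e : A) : E.Reaches (E.source e) (E.range e) := ⟨[e], rfl, rfl⟩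

/-- Loop erasure: a path may be taken to visit no vertex twice. -/
theorem Reaches.exists_nodup {v w : V} (h : E.Reaches v w) :
    ∃ p, E.IsPath v p w ∧ (p.map E.source).Nodup ∧ w ∉ p.map E.source := by
  obtain ⟨p, hp⟩ := h
  induction p generalizing v with
  | nil => cases hp; exact ⟨[], rfl, by simp, by simp⟩
  | cons e p ih =>
    obtain ⟨q, hq, hn, hw⟩ := ih hp.2
    by_cases hvw : v = w
    · subst hvw; exact ⟨[], rfl, by simp, by simp⟩
    by_cases hv : v ∈ q.map E.source
    -- The vertex `v` recurs on `q`: drop `e` and the part of `q` before the recurrence.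
    · obtain ⟨f, hf, rfl⟩ := List.mem_map.1 hv
      obtain ⟨q₁, q₂, rfl⟩ := List.append_of_mem hf
      obtain ⟨u, -, hu⟩ := hq.of_append
      rw [List.map_append] at hn hw
      exact ⟨f :: q₂, ⟨rfl, hu.2⟩, hn.of_append_right,
        fun h => hw (List.mem_append_right _ h)⟩
    · refine ⟨e :: q, ⟨hp.1, hq⟩, ?_, ?_⟩
      · rw [List.map_cons, hp.1]; exact List.nodup_cons.2 ⟨hv, hn⟩
      · rw [List.map_cons, hp.1, List.mem_cons]
        exact fun h => h.elim (fun h => hvw h.symm) hw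

/-- An edge from whose range its source can be reached lies on a cycle. -/
theorem exists_isCycle_of_reaches {e : A} (h : E.Reaches (E.range e) (E.source e)) :
    ∃ c, E.IsCycle c ∧ e ∈ c ∧ E.range e ∈ E.cycleVertices c := by
  obtain ⟨p, hp, hn, hs⟩ := h.exists_nodup
  refine ⟨e :: p, ⟨by simp, ⟨_, rfl, hp⟩, List.nodup_cons.2 ⟨hs, hn⟩⟩, by simp, ?_⟩
  cases p with
  | nil => exact ⟨e, by simp, hp.symm⟩
  | cons f p => exact ⟨f, by simp, hp.1⟩

/-- A cycle may be rotated so as to start at any of its vertices. -/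
theorem IsCycle.exists_rotation {c : List A} (hc : E.IsCycle c) {v : V}
    (hv : v ∈ E.cycleVertices c) :
    ∃ e p, (e :: p).IsRotated c ∧ E.source e = v ∧ E.IsPath (E.range e) p v ∧
      v ∉ p.map E.source := by
  obtain ⟨e, he, rfl⟩ := hv
  obtain ⟨-, ⟨u, hu⟩, hn⟩ := hc
  obtain ⟨p, q, rfl⟩ := List.append_of_mem he
  obtain ⟨w, hp, hq⟩ := hu.of_append
  obtain ⟨hw, hq⟩ := hq
  subst hw
  refine ⟨e, q ++ p, ?_, rfl, hq.append hp, ?_⟩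
  · rw [← List.cons_append]; exact List.isRotated_append
  · have h : ((e :: (q ++ p)).map E.source).Nodup := by
      refine (List.Perm.nodup_iff ?_).1 hn
      exact List.Perm.map _ (List.perm_append_comm)
    exact (List.nodup_cons.1 h).1

theorem IsCycle.reaches {c : List A} (hc : E.IsCycle c) {v w : V} (hv : v ∈ E.cycleVertices c)
    (hw : w ∈ E.cycleVertices c) : E.Reaches v w := by
  obtain ⟨e, p, hr, rfl, hp, -⟩ := hc.exists_rotation hv
  obtain ⟨f, hf, rfl⟩ := hw
  obtain ⟨q₁, q₂, hq⟩ := List.append_of_mem (hr.mem_iff.2 hf)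
  have h : E.IsPath (E.source e) (e :: p) (E.source e) := ⟨rfl, hp⟩
  rw [hq] at h
  obtain ⟨u, h₁, h₂⟩ := h.of_append
  exact ⟨q₁, h₂.1 ▸ h₁⟩

theorem IsCycle.nonempty {c : List A} (hc : E.IsCycle c) : (E.cycleVertices c).Nonempty :=
  let ⟨e, he⟩ := List.exists_mem_of_ne_nil _ hc.1
  ⟨_, e, he, rfl⟩

variable (E) in
theorem mem_cycleHull_iff {w : V} :
    w ∈ E.cycleHull ↔ ∃ c, E.IsCycle c ∧ ∃ v ∈ E.cycleVertices c, E.Reaches v w := by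
  constructor
  · intro hw
    suffices h : {w | ∃ c, E.IsCycle c ∧ ∃ v ∈ E.cycleVertices c, E.Reaches v w} ∈
        {X | E.IsHereditary X ∧ ∀ c, E.IsCycle c → E.cycleVertices c ⊆ X} from
      E.isLeast_cycleHull.2 h hw
    refine ⟨?_, ?_⟩
    · rintro x ⟨c, hc, v, hv, hx⟩ y hy
      exact ⟨c, hc, v, hv, hx.trans hy⟩
    · exact fun c hc v hv => ⟨c, hc, v, hv, Reaches.refl v⟩
  · rintro ⟨c, hc, v, hv, hw⟩
    exact E.isLeast_cycleHull.1.1 v (E.isLeast_cycleHull.1.2 c hc hv) w hw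

/-- Among finitely many vertices, a nonempty set of vertices has an element that is reached back
by every element of the set reaching it. -/
theorem exists_initial [Finite V] {s : Set V} (hs : s.Nonempty) :
    ∃ v ∈ s, ∀ u ∈ s, E.Reaches u v → E.Reaches v u := by
  -- Minimise the set of predecessors: if `u` reaches `v`, its predecessors are among those of `v`,
  -- so minimality puts `v` among them.
  obtain ⟨v, hv, hmin⟩ :=
    Set.Finite.exists_minimalFor (fun v => {u | E.Reaches u v}) s s.toFinite hs
  refine ⟨v, hv, fun u hu huv => ?_⟩
  exact hmin hu (fun x (hx : E.Reaches x u) => hx.trans huv) (Reaches.refl v)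

/-- If some vertex is not reached from any cycle, then some vertex receives no edge. -/
theorem exists_isSource_of_cycleHull_ne_univ [Finite V] (h : E.cycleHull ≠ Set.univ) :
    ∃ v, ∀ e, E.range e ≠ v := by
  obtain ⟨v, hv, hmin⟩ := exists_initial (E := E) (s := E.cycleHullᶜ)
    (Set.nonempty_compl.2 h)
  refine ⟨v, ?_⟩
  rintro e rfl
  have hs : E.source e ∉ E.cycleHull := fun hs =>
    hv (E.isLeast_cycleHull.1.1 _ hs _ (E.reaches_edge e))
  obtain ⟨c, hc, he, -⟩ := exists_isCycle_of_reaches (hmin _ hs (E.reaches_edge e))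
  exact hs (E.isLeast_cycleHull.1.2 c hc ⟨e, he, rfl⟩)

/-- If every vertex is reached from a cycle, then the only edges ending on an exclusive maximal
cycle are its own. -/
theorem IsExclusiveCycle.mem_of_range_mem {c : List A} (hc : E.IsExclusiveCycle c)
    (hmax : E.IsMaximalCycle c) (h : E.cycleHull = Set.univ) {e : A}
    (he : E.range e ∈ E.cycleVertices c) : e ∈ c := by
  -- Some cycle `d` reaches the source of `e`, hence reaches `c`; by maximality `c` reaches `d` and
  -- so that source. Thus `e` lies on a cycle meeting `c`, which exclusivity makes a rotation of
  -- `c`.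
  obtain ⟨d, hd, v, hv, hvs⟩ := E.mem_cycleHull_iff.1 (h ▸ Set.mem_univ (E.source e))
  obtain ⟨x, hx, y, hy, hxy⟩ := hmax.2 d hd ⟨v, hv, _, he, hvs.trans (E.reaches_edge e)⟩
  obtain ⟨d', hd', hed, hrd⟩ := exists_isCycle_of_reaches
    ((hc.1.reaches he hx).trans (hxy.trans ((hd.reaches hy hv).trans hvs)))
  exact (hc.2 d' hd' ⟨_, he, hrd⟩).mem_iff.1 hed

/-- A vertex at which two closed paths start, neither of which is a prefix of the other. -/
def IsBranching (E : DirectedGraph V A) (v : V) : Prop :=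
  ∃ p q, E.IsPath v p v ∧ E.IsPath v q v ∧ ¬ p <+: q ∧ ¬ q <+: p

/-- A proper prefix ending at `v` would make the longer path leave `v` again in its interior, but
`q` has no edge with source `v`. -/
theorem not_prefix_of_first_return {e f : A} {p q : List A} {v : V}
    (hp : E.IsPath (E.range e) p v) (hq : v ∉ q.map E.source) (hf : E.IsPath (E.range f) q v)
    (hne : e :: p ≠ f :: q) : ¬ e :: p <+: f :: q := by
  rintro ⟨t, ht⟩
  obtain ⟨rfl, rfl⟩ := List.cons.inj ht
  cases t with
  | nil => simp at hne
  | cons g t =>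
    obtain ⟨u, hu, hu'⟩ := hf.of_append
    have key : ∀ (x : V) (l : List A), E.IsPath x l v → E.IsPath x l u → u = v := by
      intro x l
      induction l generalizing x with
      | nil => exact fun h h' => h'.symm.trans h
      | cons a l ih => exact fun h h' => ih _ h.2 h'.2
    have := key _ _ hp hu
    exact hq (List.mem_map.2 ⟨g, by simp, hu'.1.trans this⟩)

/-- A cycle that is not exclusive has a branching vertex. -/
theorem IsCycle.exists_isBranching {c : List A} (hc : E.IsCycle c) (h : ¬ E.IsExclusiveCycle c) :
    ∃ v ∈ E.cycleVertices c, E.IsBranching v := by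
  have : ∃ d, E.IsCycle d ∧ (E.cycleVertices c ∩ E.cycleVertices d).Nonempty ∧
      ¬ d.IsRotated c := by
    by_contra hd
    push Not at hd
    exact h ⟨hc, hd⟩
  obtain ⟨d, hd, ⟨v, hvc, hvd⟩, hr⟩ := this
  obtain ⟨e, p, hep, he, hp, hvp⟩ := hc.exists_rotation hvc
  obtain ⟨f, q, hfq, hf, hq, hvq⟩ := hd.exists_rotation hvd
  have hne : e :: p ≠ f :: q := fun heq => hr (hfq.symm.trans (heq ▸ hep))
  exact ⟨v, hvc, e :: p, f :: q, ⟨he, hp⟩, ⟨hf, hq⟩,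
    not_prefix_of_first_return hp hvq hq hne, not_prefix_of_first_return hq hvp hp hne.symm⟩

/-- If every vertex is reached from a cycle and no maximal cycle is exclusive, then every vertex is
reached from a branching vertex. -/
theorem exists_isBranching_reaches [Finite V] (h : E.cycleHull = Set.univ)
    (hex : ¬ ∃ c, E.IsExclusiveCycle c ∧ E.IsMaximalCycle c) (w : V) :
    ∃ v, E.IsBranching v ∧ E.Reaches v w := by
  obtain ⟨c₀, hc₀, v₀, hv₀, hw₀⟩ := E.mem_cycleHull_iff.1 (h ▸ Set.mem_univ w)
  -- An initial vertex among the cycle vertices reaching `w` lies on a maximal cycle, which by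
  -- assumption is not exclusive and so has a branching vertex.
  obtain ⟨v, ⟨⟨c, hc, hv⟩, hvw⟩, hmin⟩ := exists_initial (E := E)
    (s := {v | (∃ c, E.IsCycle c ∧ v ∈ E.cycleVertices c) ∧ E.Reaches v w})
    ⟨v₀, ⟨c₀, hc₀, hv₀⟩, hw₀⟩
  have hmax : E.IsMaximalCycle c := by
    refine ⟨hc, ?_⟩
    rintro d hd ⟨x, hx, y, hy, hxy⟩
    have hxv := hxy.trans (hc.reaches hy hv)
    exact ⟨v, hv, x, hx, hmin x ⟨⟨d, hd, hx⟩, hxv.trans hvw⟩ hxv⟩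
  obtain ⟨u, hu, hb⟩ := hc.exists_isBranching fun hc' => hex ⟨c, hc', hmax⟩
  exact ⟨u, hb, (hc.reaches hu hv).trans hvw⟩

end DirectedGraph

/-! ### The rank condition in terms of matrices -/

section RankCondition

/-- Right-linear maps between free modules are left multiplications by matrices, and a surjection
onto a free module splits. -/
theorem hasEpiSucc_iff {S : Type*} [Ring S] {n : ℕ} :
    HasEpiSucc S n ↔
      ∃ (M : Matrix (Fin (n + 1)) (Fin n) S) (N : Matrix (Fin n) (Fin (n + 1)) S), M * N = 1 := by
  constructor
  · rintro ⟨f, hf⟩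
    choose g hg using hf
    refine ⟨.of fun i j => f (Pi.single j 1) i, .of fun i j => g (Pi.single j 1) i, ?_⟩
    ext i k
    have hx (x : Fin n → S) : f x i = ∑ j, f (Pi.single j 1) i * x j := by
      have : x = ∑ j, MulOpposite.op (x j) • (Pi.single j 1 : Fin n → S) := by
        ext l
        simp [Finset.sum_apply, Pi.single_apply]
      conv_lhs => rw [this]
      simp [map_sum, Finset.sum_apply]
    rw [Matrix.mul_apply]
    simp only [Matrix.of_apply]
    rw [← hx, hg, Pi.single_apply, Matrix.one_apply]
  · rintro ⟨M, N, h⟩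
    refine ⟨{ toFun := M.mulVec, map_add' := M.mulVec_add, map_smul' := fun c x => ?_ },
      fun y => ⟨N.mulVec y, ?_⟩⟩
    · ext i
      simp [Matrix.mulVec, dotProduct, Finset.sum_mul, mul_assoc]
    · simp [Matrix.mulVec_mulVec, h]

theorem HasEpiSucc.map {S T : Type*} [Ring S] [Ring T] (f : S →+* T) {n : ℕ}
    (h : HasEpiSucc S n) : HasEpiSucc T n := by
  obtain ⟨M, N, h⟩ := hasEpiSucc_iff.1 h
  refine hasEpiSucc_iff.2 ⟨M.map f, N.map f, ?_⟩
  rw [← Matrix.map_mul, h, Matrix.map_one f f.map_zero f.map_one]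

theorem SatisfiesRankCondition.of_ringHom {S T : Type*} [Ring S] [Ring T] (f : S →+* T)
    (h : SatisfiesRankCondition T) : SatisfiesRankCondition S :=
  fun n hn hS => h n hn (hS.map f)

/-- Flattening blocks turns `M * N = 1` into an identity over `S` of size (n+1)|ι|, factored through
n|ι|. As |ι| ≥ 1, n|ι|+1 of the rows of `M` and the matching columns of `N` can be kept. -/
theorem SatisfiesRankCondition.matrix {S : Type*} [Ring S] (h : SatisfiesRankCondition S)
    (ι : Type*) [Fintype ι] [DecidableEq ι] [Nonempty ι] :
    SatisfiesRankCondition (Matrix ι ι S) := by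
  intro n hn hM
  obtain ⟨M, N, hMN⟩ := hasEpiSucc_iff.1 hM
  have hcard : 0 < Fintype.card ι := Fintype.card_pos
  obtain ⟨e⟩ : Nonempty (Fin (n * Fintype.card ι) ≃ Fin n × ι) :=
    ⟨(Fintype.equivFinOfCardEq (by simp)).symm⟩
  obtain ⟨g⟩ : Nonempty (Fin (n * Fintype.card ι + 1) ↪ Fin (n + 1) × ι) := by
    refine Function.Embedding.nonempty_of_card_le ?_
    simp only [Fintype.card_fin, Fintype.card_prod]
    rw [add_mul]
    omega
  have hcomp : (Matrix.of fun (i : Fin (n + 1) × ι) (j : Fin n × ι) => M i.1 j.1 i.2 j.2) *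
      (Matrix.of fun (i : Fin n × ι) (j : Fin (n + 1) × ι) => N i.1 j.1 i.2 j.2) = 1 := by
    ext ⟨i, a⟩ ⟨j, b⟩
    have := congr_fun₂ (congr_fun₂ hMN i j) a b
    rw [Matrix.mul_apply, Matrix.sum_apply] at this
    simp only [Matrix.mul_apply] at this ⊢
    rw [Fintype.sum_prod_type]
    simp only [Matrix.of_apply]
    rw [this]
    by_cases hij : i = j <;> simp [Matrix.one_apply, hij]
  refine h (n * Fintype.card ι) (Nat.mul_pos hn hcard) (hasEpiSucc_iff.2
    ⟨(Matrix.of fun (i : Fin (n + 1) × ι) (j : Fin n × ι) => M i.1 j.1 i.2 j.2).submatrix g e,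
      (Matrix.of fun (i : Fin n × ι) (j : Fin (n + 1) × ι) => N i.1 j.1 i.2 j.2).submatrix e g, ?_⟩)
  rw [Matrix.submatrix_mul_equiv, hcomp, Matrix.submatrix_one _ g.injective]

theorem one_lt_generatingNumber_iff {S : Type*} [Ring S] :
    1 < generatingNumber S ↔ ¬ HasEpiSucc S 1 := by
  unfold generatingNumber
  split_ifs with h
  · simpa using h 1 one_pos
  -- Nonemptiness rules out the default value `sInf ∅ = 0`.
  · have hne : {n : ℕ | 0 < n ∧ HasEpiSucc S n}.Nonempty := by
      by_contra hemp
      exact h fun n hn hS => hemp ⟨n, hn, hS⟩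
    rw [Nat.one_lt_cast]
    constructor
    · intro hlt hS
      exact (Nat.sInf_le (show 1 ∈ {n : ℕ | 0 < n ∧ HasEpiSucc S n} from ⟨one_pos, hS⟩)).not_gt hlt
    · intro hS
      obtain ⟨hpos, hmem⟩ := Nat.sInf_mem hne
      refine lt_of_le_of_ne hpos fun heq => hS ?_
      rwa [← heq] at hmem

end RankCondition

/-! ### Truncated matrix units -/

section MatrixUnits

variable (R : Type*) [Ring R] {V : Type*} (Y : Set V)

open Classical in
/-- The matrix unit at `(a, b)`, restricted to the rows and columns in `Y`. -/
noncomputable def matrixUnitOn (a b : V) : Matrix Y Y R :=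
  .of fun i j => if (i : V) = a ∧ (j : V) = b then 1 else 0

variable {Y}

theorem matrixUnitOn_of_left_notMem {a : V} (b : V) (h : a ∉ Y) : matrixUnitOn R Y a b = 0 := by
  ext i j
  have : (i : V) ≠ a := fun hi => h (hi ▸ i.2)
  simp [matrixUnitOn, this]

theorem matrixUnitOn_of_right_notMem (a : V) {b : V} (h : b ∉ Y) : matrixUnitOn R Y a b = 0 := by
  ext i j
  have : (j : V) ≠ b := fun hi => h (hi ▸ j.2)
  simp [matrixUnitOn, this]

variable [Fintype Y]

theorem matrixUnitOn_mul_of_ne (a d : V) {b c : V} (h : b ≠ c) :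
    matrixUnitOn R Y a b * matrixUnitOn R Y c d = 0 := by
  ext i j
  rw [Matrix.mul_apply, Matrix.zero_apply]
  refine Finset.sum_eq_zero fun k _ => ?_
  by_cases hk : (k : V) = b
  · have : (k : V) ≠ c := fun hc => h (hk.symm.trans hc)
    simp [matrixUnitOn, this]
  · simp [matrixUnitOn, hk]

theorem matrixUnitOn_mul (a d : V) {b : V} (h : b ∈ Y) :
    matrixUnitOn R Y a b * matrixUnitOn R Y b d = matrixUnitOn R Y a d := by
  ext i j
  rw [Matrix.mul_apply, Finset.sum_eq_single ⟨b, h⟩]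
  · simp only [matrixUnitOn, Matrix.of_apply, ite_and, mul_ite, mul_one, mul_zero, if_true]
    split_ifs <;> rfl
  · intro k _ hk
    have : (k : V) ≠ b := fun hb => hk (Subtype.ext hb)
    simp [matrixUnitOn, this]
  · simp

variable {R}

theorem commute_scalar_matrixUnitOn [DecidableEq Y] (r : R) (a b : V) :
    Commute (Matrix.scalar Y r) (matrixUnitOn R Y a b) := by
  ext i j
  simp [Matrix.scalar_apply, matrixUnitOn]

end MatrixUnits

namespace CohnPathRing

variable (R : Type*) [Ring R] {V A : Type*} [Fintype V] (E : DirectedGraph V A)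

/-- The canonical homomorphism from the coefficient ring. -/
noncomputable def coeff : R →+* CohnPathRing R E :=
  (RingQuot.mkRingHom (CohnRel R E)).comp MonoidAlgebra.singleOneRingHom

/-! ### Universal property and matrix representations -/

section Lift

variable {R}

/-- A homomorphism from the coefficients and images of the generators commuting with its values,
compatible with the relations, induce a homomorphism on the Cohn path ring. -/
theorem exists_ringHom {T : Type*} [Ring T] (f : R →+* T) (x : V → T) (y z : A → T)
    (hx : ∀ r v, Commute (f r) (x v)) (hy : ∀ r e, Commute (f r) (y e))
    (hz : ∀ r e, Commute (f r) (z e))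
    (vertex_mul_self : ∀ v, x v * x v = x v)
    (vertex_mul_of_ne : ∀ v w, v ≠ w → x v * x w = 0)
    (source_mul_edge : ∀ e, x (E.source e) * y e = y e)
    (edge_mul_range : ∀ e, y e * x (E.range e) = y e)
    (sum_vertex : ∑ v, x v = 1)
    (range_mul_ghost : ∀ e, x (E.range e) * z e = z e)
    (ghost_mul_source : ∀ e, z e * x (E.source e) = z e)
    (ghost_mul_self : ∀ e, z e * y e = x (E.range e))
    (ghost_mul_of_ne : ∀ e e', e ≠ e' → z e * y e' = 0) :
    Nonempty (CohnPathRing R E →+* T) := by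
  let g : CohnGen V A → T := fun a => match a with
    | .vertex v => x v
    | .edge e => y e
    | .ghost e => z e
  have hg (r : R) (a : CohnGen V A) : Commute (f r) (g a) := by
    cases a with
    | vertex v => exact hx r v
    | edge e => exact hy r e
    | ghost e => exact hz r e
  let φ : CohnFree R V A →+* T := MonoidAlgebra.liftNCRingHom f (FreeMonoid.lift g) (by
    intro r m
    induction m using FreeMonoid.inductionOn' with
    | one => simp
    | of_mul a m ih => rw [map_mul, FreeMonoid.lift_eval_of]; exact (hg r a).mul_right ih)
  have hφ (a : CohnGen V A) : φ (MonoidAlgebra.of R _ (FreeMonoid.of a)) = g a := by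
    simp [φ, MonoidAlgebra.liftNCRingHom]
  have hv (v : V) : φ (CohnFree.vertex R v) = x v := hφ _
  have he (e : A) : φ (CohnFree.edge R e) = y e := hφ _
  have hgh (e : A) : φ (CohnFree.ghost R e) = z e := hφ _
  refine ⟨RingQuot.lift ⟨φ, ?_⟩⟩
  intro a b hab
  cases hab with
  | vertex_mul_self v => simpa [hv] using vertex_mul_self v
  | vertex_mul_of_ne v w h => simpa [hv] using vertex_mul_of_ne v w h
  | source_mul_edge e => simpa [hv, he] using source_mul_edge e
  | edge_mul_range e => simpa [hv, he] using edge_mul_range e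
  | sum_vertex => simpa [hv] using sum_vertex
  | range_mul_ghost e => simpa [hv, hgh] using range_mul_ghost e
  | ghost_mul_source e => simpa [hv, hgh] using ghost_mul_source e
  | ghost_mul_self e => simpa [hv, he, hgh] using ghost_mul_self e
  | ghost_mul_of_ne e e' h => simpa [hv, he, hgh] using ghost_mul_of_ne e e' h

/-- If `Y` is closed under predecessors and the edges ending in `Y` have distinct sources, then the
Cohn path ring is represented by matrices indexed by `Y`. -/
theorem exists_ringHom_matrix {Y : Set V} [Fintype Y] [DecidableEq Y]
    (hY : ∀ e, E.range e ∈ Y → E.source e ∈ Y)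
    (hinj : ∀ e f, E.range e ∈ Y → E.range f ∈ Y → E.source e = E.source f → e = f) :
    Nonempty (CohnPathRing R E →+* Matrix Y Y R) := by
  refine exists_ringHom E (Matrix.scalar Y) (fun v => matrixUnitOn R Y v v)
    (fun e => matrixUnitOn R Y (E.source e) (E.range e))
    (fun e => matrixUnitOn R Y (E.range e) (E.source e))
    (fun r v => commute_scalar_matrixUnitOn r _ _) (fun r e => commute_scalar_matrixUnitOn r _ _)
    (fun r e => commute_scalar_matrixUnitOn r _ _) ?_ ?_ ?_ ?_ ?_ ?_ ?_ ?_ ?_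
  · intro v
    by_cases h : v ∈ Y
    · exact matrixUnitOn_mul R _ _ h
    · simp [matrixUnitOn_of_left_notMem R _ h]
  · exact fun v w h => matrixUnitOn_mul_of_ne R _ _ h
  · intro e
    by_cases h : E.source e ∈ Y
    · exact matrixUnitOn_mul R _ _ h
    · simp [matrixUnitOn_of_left_notMem R _ h]
  · intro e
    by_cases h : E.range e ∈ Y
    · exact matrixUnitOn_mul R _ _ h
    · simp [matrixUnitOn_of_right_notMem R _ h]
  · ext i j
    rw [Matrix.sum_apply, Finset.sum_eq_single (i : V)]
    · by_cases h : i = j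
      · subst h; simp [matrixUnitOn]
      · have : (j : V) ≠ i := fun h' => h (Subtype.ext h'.symm)
        simp [matrixUnitOn, h, this]
    · intro v _ hv
      simp [matrixUnitOn, hv.symm]
    · simp
  · intro e
    by_cases h : E.range e ∈ Y
    · exact matrixUnitOn_mul R _ _ h
    · simp [matrixUnitOn_of_left_notMem R _ h]
  · intro e
    by_cases h : E.source e ∈ Y
    · exact matrixUnitOn_mul R _ _ h
    · simp [matrixUnitOn_of_right_notMem R _ h]
  -- The relation e*e = r(e) needs the middle index s(e) in `Y`; this is where closure under
  -- predecessors enters. When r(e) is outside `Y`, both sides vanish.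
  · intro e
    by_cases h : E.range e ∈ Y
    · exact matrixUnitOn_mul R _ _ (hY e h)
    · simp [matrixUnitOn_of_left_notMem R _ h]
  · intro e f hne
    by_cases he : E.range e ∈ Y
    · by_cases hf : E.range f ∈ Y
      · exact matrixUnitOn_mul_of_ne R _ _ fun h => hne (hinj e f he hf h)
      · simp [matrixUnitOn_of_right_notMem R _ hf]
    · simp [matrixUnitOn_of_left_notMem R _ he]

end Lift

/-! ### Independent copies of projective modules -/

/-- The image of a vertex. -/
noncomputable def vert (v : V) : CohnPathRing R E := RingQuot.mkRingHom _ (CohnFree.vertex R v)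

/-- The image of a path: the product of its edges. -/
noncomputable def path (p : List A) : CohnPathRing R E :=
  (p.map fun e => RingQuot.mkRingHom (CohnRel R E) (CohnFree.edge R e)).prod

/-- The image of the adjoint of a path: the product of the ghost edges in the reverse order. -/
noncomputable def ghostPath (p : List A) : CohnPathRing R E :=
  (p.reverse.map fun e => RingQuot.mkRingHom (CohnRel R E) (CohnFree.ghost R e)).prod

theorem vert_mul_self (v : V) : vert R E v * vert R E v = vert R E v := by
  simpa [vert] using RingQuot.mkRingHom_rel (CohnRel.vertex_mul_self (R := R) (E := E) v)

theorem vert_mul_of_ne {v w : V} (h : v ≠ w) : vert R E v * vert R E w = 0 := by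
  simpa [vert] using RingQuot.mkRingHom_rel (CohnRel.vertex_mul_of_ne (R := R) (E := E) v w h)

theorem sum_vert : ∑ v, vert R E v = 1 := by
  simpa [vert] using RingQuot.mkRingHom_rel (CohnRel.sum_vertex (R := R) (E := E))

/-- The vertex in the middle records the base point, which an empty list of edges forgets. -/
theorem ghostPath_mul_vert_mul_path_cons_self (e : A) (p q : List A) :
    ghostPath R E (e :: p) * vert R E (E.source e) * path R E (e :: q) =
      ghostPath R E p * vert R E (E.range e) * path R E q := by
  have h₁ := RingQuot.mkRingHom_rel (CohnRel.source_mul_edge (R := R) (E := E) e)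
  have h₂ := RingQuot.mkRingHom_rel (CohnRel.ghost_mul_self (R := R) (E := E) e)
  rw [map_mul] at h₁ h₂
  simp only [ghostPath, path, vert, List.reverse_cons, List.map_append, List.map_cons, List.map_nil,
    List.prod_append, List.prod_cons, List.prod_nil, mul_one, mul_assoc, ← h₂]
  rw [← mul_assoc (RingQuot.mkRingHom _ (CohnFree.vertex R (E.source e))), h₁]

theorem ghostPath_mul_vert_mul_path_cons_of_ne {e f : A} (h : e ≠ f)
    (p q : List A) :
    ghostPath R E (e :: p) * vert R E (E.source f) * path R E (f :: q) = 0 := by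
  have h₁ := RingQuot.mkRingHom_rel (CohnRel.source_mul_edge (R := R) (E := E) f)
  have h₂ := RingQuot.mkRingHom_rel (CohnRel.ghost_mul_of_ne (R := R) (E := E) e f h)
  rw [map_mul] at h₁ h₂
  rw [map_zero] at h₂
  simp only [ghostPath, path, vert, List.reverse_cons, List.map_append, List.map_cons, List.map_nil,
    List.prod_append, List.prod_cons, List.prod_nil, mul_one, mul_assoc]
  rw [← mul_assoc (RingQuot.mkRingHom _ (CohnFree.vertex R (E.source f))), h₁,
    ← mul_assoc (RingQuot.mkRingHom _ (CohnFree.ghost R e)), h₂, zero_mul, mul_zero]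

variable {E}

theorem ghostPath_mul_path_self {v w : V} {p : List A} (h : E.IsPath v p w) :
    ghostPath R E p * vert R E v * path R E p = vert R E w := by
  induction p generalizing v with
  | nil => cases h; simp [ghostPath, path]
  | cons e p ih =>
    obtain ⟨rfl, h⟩ := h
    rw [ghostPath_mul_vert_mul_path_cons_self, ih h]

/-- Common initial edges cancel; as neither path is a prefix of the other, two distinct edges then
meet and give zero. -/
theorem ghostPath_mul_path_of_not_prefix {v w w' : V} {p q : List A} (hp : E.IsPath v p w)
    (hq : E.IsPath v q w') (hpq : ¬ p <+: q) (hqp : ¬ q <+: p) :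
    ghostPath R E p * vert R E v * path R E q = 0 := by
  induction p generalizing v q with
  | nil => simp at hpq
  | cons e p ih =>
    cases q with
    | nil => simp at hqp
    | cons f q =>
      obtain ⟨rfl, hq⟩ := hq
      by_cases hef : e = f
      · subst hef
        rw [ghostPath_mul_vert_mul_path_cons_self]
        exact ih hp.2 hq (by simpa using hpq) (by simpa using hqp)
      · exact ghostPath_mul_vert_mul_path_cons_of_ne R E hef p q

/-- A path from `v` to `w` exhibits the projective module of `w` as a direct summand of that
of `v`. -/
theorem exists_of_reaches {v w : V} (h : E.Reaches v w) :
    ∃ a b : CohnPathRing R E, a * vert R E v * b = vert R E w := by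
  obtain ⟨p, hp⟩ := h
  exact ⟨_, _, ghostPath_mul_path_self R hp⟩

/-- The projective module of a branching vertex contains infinitely many independent copies of
itself. -/
theorem exists_orthogonal_of_isBranching {v : V} (h : E.IsBranching v) :
    ∃ y x : ℕ → CohnPathRing R E, (∀ k, y k * vert R E v = y k) ∧ (∀ k, vert R E v * x k = x k) ∧
      (∀ k, y k * x k = vert R E v) ∧ ∀ k l, k ≠ l → y k * x l = 0 := by
  obtain ⟨p, q, hp, hq, hpq, hqp⟩ := h
  set u := vert R E v with hu
  have huu : u * u = u := vert_mul_self R E v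
  obtain ⟨y₁, hy₁⟩ : ∃ y, y = u * ghostPath R E p * u := ⟨_, rfl⟩
  obtain ⟨y₂, hy₂⟩ : ∃ y, y = u * ghostPath R E q * u := ⟨_, rfl⟩
  obtain ⟨x₁, hx₁⟩ : ∃ x, x = u * path R E p * u := ⟨_, rfl⟩
  obtain ⟨x₂, hx₂⟩ : ∃ x, x = u * path R E q * u := ⟨_, rfl⟩
  have hyu₁ : y₁ * u = y₁ := by rw [hy₁, mul_assoc, huu]
  have hyu₂ : y₂ * u = y₂ := by rw [hy₂, mul_assoc, huu]
  have hux₁ : u * x₁ = x₁ := by rw [hx₁, ← mul_assoc, ← mul_assoc, huu]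
  have hux₂ : u * x₂ = x₂ := by rw [hx₂, ← mul_assoc, ← mul_assoc, huu]
  have hprod (a b : CohnPathRing R E) : u * a * u * (u * b * u) = u * (a * u * b) * u := by
    calc _ = u * a * (u * u) * b * u := by simp only [mul_assoc]
      _ = _ := by rw [huu]; simp only [mul_assoc]
  have h₁₁ : y₁ * x₁ = u := by
    rw [hy₁, hx₁, hprod, ghostPath_mul_path_self R hp, ← hu, huu, huu]
  have h₂₂ : y₂ * x₂ = u := by
    rw [hy₂, hx₂, hprod, ghostPath_mul_path_self R hq, ← hu, huu, huu]
  have h₁₂ : y₁ * x₂ = 0 := by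
    rw [hy₁, hx₂, hprod, ghostPath_mul_path_of_not_prefix R hp hq hpq hqp, mul_zero, zero_mul]
  have h₂₁ : y₂ * x₁ = 0 := by
    rw [hy₂, hx₁, hprod, ghostPath_mul_path_of_not_prefix R hq hp hqp hpq, mul_zero, zero_mul]
  -- Cancelling `y₁ * x₁` leaves a factor `u`, to be absorbed on its left.
  have hy (k : ℕ) : y₂ * y₁ ^ k * u = y₂ * y₁ ^ k := by
    cases k with
    | zero => simpa using hyu₂
    | succ k => rw [pow_succ, ← mul_assoc, mul_assoc _ y₁, hyu₁]
  have hstep (k l : ℕ) : y₂ * y₁ ^ (k + 1) * (x₁ ^ (l + 1) * x₂) =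
      y₂ * y₁ ^ k * (x₁ ^ l * x₂) := by
    calc _ = y₂ * y₁ ^ k * (y₁ * x₁) * (x₁ ^ l * x₂) := by
          rw [pow_succ, pow_succ']; simp only [mul_assoc]
      _ = _ := by rw [h₁₁, hy]
  -- These come from the paths p^k q. Cancelling reduces y₂ y₁^k x₁^l x₂ to `y₂ * x₂` if k = l;
  -- otherwise a factor `y₂ * x₁` or `y₁ * x₂` appears.
  refine ⟨fun k => y₂ * y₁ ^ k, fun k => x₁ ^ k * x₂, hy, fun k => ?_, fun k => ?_, fun k => ?_⟩
  · cases k with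
    | zero => simpa using hux₂
    | succ k => simp only [pow_succ', ← mul_assoc, hux₁]
  · induction k with
    | zero => simpa using h₂₂
    | succ k ih => rw [hstep, ih]
  · induction k with
    | zero =>
      rintro (_ | l) hl
      · exact absurd rfl hl
      · beta_reduce
        rw [pow_zero, mul_one, pow_succ', mul_assoc, ← mul_assoc, h₂₁, zero_mul]
    | succ k ih =>
      rintro (_ | l) hl
      · beta_reduce
        rw [pow_zero, one_mul, pow_succ, mul_assoc, mul_assoc, h₁₂, mul_zero, mul_zero]
      · rw [hstep]
        exact ih l fun h => hl (h ▸ rfl)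

theorem hasEpiSucc_one_of_branching (h : ∀ w, ∃ v, E.IsBranching v ∧ E.Reaches v w) :
    HasEpiSucc (CohnPathRing R E) 1 := by
  choose v hv hvw using h
  choose a b hab using fun w => exists_of_reaches R (hvw w)
  choose! y x hyu hux hyx hyx' using fun v (hv : E.IsBranching v) =>
    exists_orthogonal_of_isBranching R hv
  -- Each of the two copies of each vertex gets its own slot, so copies sharing a branching vertex
  -- are independent; distinct branching vertices are orthogonal anyway.
  obtain ⟨κ, hκ⟩ := Countable.exists_injective_nat (V × Fin 2)
  let M (w : V) (i : Fin 2) : CohnPathRing R E := vert R E w * a w * y (v w) (κ (w, i))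
  let N (w : V) (i : Fin 2) : CohnPathRing R E := x (v w) (κ (w, i)) * b w * vert R E w
  have hassoc (w w' : V) (i j : Fin 2) : M w i * N w' j =
      vert R E w * a w * (y (v w) (κ (w, i)) * x (v w') (κ (w', j))) * b w' * vert R E w' := by
    simp only [M, N, mul_assoc]
  have hself (w : V) (i : Fin 2) : M w i * N w i = vert R E w := by
    rw [hassoc, hyx _ (hv w), mul_assoc (vert R E w), mul_assoc (vert R E w), hab, vert_mul_self,
      vert_mul_self]
  have hne (w w' : V) (i j : Fin 2) (h : (w, i) ≠ (w', j)) : M w i * N w' j = 0 := by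
    suffices y (v w) (κ (w, i)) * x (v w') (κ (w', j)) = 0 by simp [hassoc, this]
    by_cases hvv : v w = v w'
    · rw [← hvv]
      exact hyx' _ (hv w) _ _ fun hk => h (hκ hk)
    · rw [← hyu _ (hv w), ← hux _ (hv w'), mul_assoc, ← mul_assoc (vert R E (v w)),
        vert_mul_of_ne R E hvv, zero_mul, mul_zero]
  refine hasEpiSucc_iff.2 ⟨.of fun i _ => ∑ w, M w i, .of fun _ j => ∑ w, N w j, ?_⟩
  ext i j
  simp only [Matrix.mul_apply, Matrix.of_apply, Finset.univ_unique, Finset.sum_singleton]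
  rw [Finset.sum_mul_sum]
  by_cases hij : i = j
  · subst hij
    rw [Matrix.one_apply_eq, ← sum_vert R E]
    refine Finset.sum_congr rfl fun w _ => ?_
    rw [Finset.sum_eq_single w (fun w' _ hw => hne _ _ _ _ (by simp [hw.symm])) (by simp), hself]
  · rw [Matrix.one_apply_ne hij]
    exact Finset.sum_eq_zero fun w _ => Finset.sum_eq_zero fun w' _ =>
      hne _ _ _ _ (by simp [hij])

/-! ### Sufficient conditions for the rank condition -/

variable {R}

theorem satisfiesRankCondition_of_set (hR : SatisfiesRankCondition R) {Y : Set V}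
    (hne : Y.Nonempty) (hY : ∀ e, E.range e ∈ Y → E.source e ∈ Y)
    (hinj : ∀ e f, E.range e ∈ Y → E.range f ∈ Y → E.source e = E.source f → e = f) :
    SatisfiesRankCondition (CohnPathRing R E) := by
  classical
  have := hne.to_subtype
  obtain ⟨φ⟩ := exists_ringHom_matrix (R := R) E hY hinj
  exact (hR.matrix Y).of_ringHom φ

theorem satisfiesRankCondition_of_cycleHull_ne_univ (hR : SatisfiesRankCondition R)
    (h : E.cycleHull ≠ Set.univ) : SatisfiesRankCondition (CohnPathRing R E) := by
  obtain ⟨v, hv⟩ := E.exists_isSource_of_cycleHull_ne_univ h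
  exact satisfiesRankCondition_of_set hR (Set.singleton_nonempty v)
    (fun e he => absurd he (hv e)) (fun e _ he => absurd he (hv e))

theorem satisfiesRankCondition_of_isExclusiveCycle (hR : SatisfiesRankCondition R) {c : List A}
    (hc : E.IsExclusiveCycle c) (hmax : E.IsMaximalCycle c) :
    SatisfiesRankCondition (CohnPathRing R E) := by
  -- If X ≠ E^0, edges from outside X may end on the cycle, so its vertices need not be closed under
  -- predecessors; the other criterion then applies.
  by_cases h : E.cycleHull = Set.univ
  · refine satisfiesRankCondition_of_set hR hc.1.nonempty
      (fun e he => ⟨e, hc.mem_of_range_mem hmax h he, rfl⟩) fun e f he hf hef => ?_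
    exact List.inj_on_of_nodup_map hc.1.2.2 (hc.mem_of_range_mem hmax h he)
      (hc.mem_of_range_mem hmax h hf) hef
  · exact satisfiesRankCondition_of_cycleHull_ne_univ hR h

end CohnPathRing

theorem corollary4p11 (R : Type*) [Ring R] {V A : Type*} [Fintype V] (E : DirectedGraph V A) :
    List.TFAE [
      SatisfiesRankCondition (CohnPathRing R E),
      SatisfiesRankCondition R ∧ 1 < generatingNumber (CohnPathRing R E),
      SatisfiesRankCondition R ∧
        (E.cycleHull ≠ Set.univ ∨ ∃ c : List A, E.IsExclusiveCycle c ∧ E.IsMaximalCycle c)] := by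
  tfae_have 1 → 2 := fun h =>
    ⟨h.of_ringHom (CohnPathRing.coeff R E), one_lt_generatingNumber_iff.2 (h 1 one_pos)⟩
  tfae_have 2 → 3 := by
    rintro ⟨hR, hgn⟩
    refine ⟨hR, ?_⟩
    by_contra! h
    exact one_lt_generatingNumber_iff.1 hgn (CohnPathRing.hasEpiSucc_one_of_branching R
      (E.exists_isBranching_reaches h.1 fun ⟨c, hc, hmax⟩ => h.2 c hc hmax))
  tfae_have 3 → 1 := by
    rintro ⟨hR, h | ⟨c, hc, hmax⟩⟩
    · exact CohnPathRing.satisfiesRankCondition_of_cycleHull_ne_univ hR h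
    · exact CohnPathRing.satisfiesRankCondition_of_isExclusiveCycle hR hc hmax
  tfae_finish
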